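/- For every $d$ there is a constant $C_d>0$, depending only on $d$, such that the following holds for every convex body $K\subset\mathbb R^d$, i.e. every closed bounded convex set with non-empty interior. Write $v+K=\{v+x:x\in K\}$ for $v\in\mathbb R^d$ and $K-K=\{x-y:x,y\in K\}$. The sets $\mathbb Z^d\cap(v+K)$, $v\in\mathbb R^d$, and $\mathbb Z^d\cap(K-K)$ are finite, the maximum $\max_{v\in\mathbb R^d}|\mathbb Z^d\cap(v+K)|$ is attained, and $$\max_{v\in\mathbb R^d}|\mathbb Z^d\cap(v+K)|\;\le\;|\mathbb Z^d\cap(K-K)|\;\le\; C_d\,\max_{v\in\mathbb R^d}|\mathbb Z^d\cap(v+K)|.$$ -/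

import Mathlib

open scoped Pointwise

/-- The integer lattice `ℤ^d`, as a subset of Euclidean space `ℝ^d`. -/
def integerLattice (d : ℕ) : Set (EuclideanSpace ℝ (Fin d)) :=
  {x | ∀ i, ∃ n : ℤ, x i = (n : ℝ)}

/-! Lower bound: subtracting one lattice point of `v + K` from the others lands in `K - K`. Upper
bound: take a simplex of maximal volume with vertices in `K`. In its edge coordinates `K - K` lies
in `[-2, 2]^d`, while the simplex, hence `K`, contains a translate of a cube of side `1/(d+1)`. So
`(4(d+1)+1)^d` half-open cubes of that side cover `K - K`, and each, fitting in a translate of `K`,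
holds at most the maximal number of lattice points. -/

theorem finite_integerLattice_inter {d : ℕ} {s : Set (EuclideanSpace ℝ (Fin d))}
    (hs : Bornology.IsBounded s) : (integerLattice d ∩ s).Finite := by
  obtain ⟨R, hR⟩ := hs.exists_norm_le
  refine ((Set.finite_Icc (fun _ : Fin d => -⌈R⌉) (fun _ => ⌈R⌉)).image
    (fun n : Fin d → ℤ => WithLp.toLp 2 (fun i => (n i : ℝ)))).subset ?_
  rintro x ⟨hx, hxs⟩
  choose n hn using hx
  have h : ∀ i, |(n i : ℝ)| ≤ (⌈R⌉ : ℝ) := fun i => by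
    rw [← hn i, ← Real.norm_eq_abs]
    exact ((PiLp.norm_apply_le x i).trans (hR x hxs)).trans (Int.le_ceil R)
  refine ⟨n, ⟨fun i => ?_, fun i => ?_⟩, ?_⟩
  · exact_mod_cast (abs_le.mp (h i)).1
  · exact_mod_cast (abs_le.mp (h i)).2
  · ext i
    exact (hn i).symm

theorem integerLattice_sub_mem {d : ℕ} {x y : EuclideanSpace ℝ (Fin d)}
    (hx : x ∈ integerLattice d) (hy : y ∈ integerLattice d) : x - y ∈ integerLattice d := by
  intro i
  obtain ⟨m, hm⟩ := hx i
  obtain ⟨n, hn⟩ := hy i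
  exact ⟨m - n, by simp [hm, hn]⟩

/-- Translating a lattice point of `v + K` to the origin injects the lattice points of `v + K`
into those of `K - K`. -/
theorem ncard_integerLattice_vadd_le {d : ℕ} {K : Set (EuclideanSpace ℝ (Fin d))}
    (hfin : (integerLattice d ∩ (K - K)).Finite) (v : EuclideanSpace ℝ (Fin d)) :
    (integerLattice d ∩ (v +ᵥ K)).ncard ≤ (integerLattice d ∩ (K - K)).ncard := by
  rcases (integerLattice d ∩ (v +ᵥ K)).eq_empty_or_nonempty with h | ⟨z, hz, hzK⟩
  · simp [h]
  · refine Set.ncard_le_ncard_of_injOn (fun x => x - z) ?_ (fun _ _ _ _ h => sub_left_injective h)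
      hfin
    rintro x ⟨hx, hxK⟩
    obtain ⟨a, ha, rfl⟩ := hxK
    obtain ⟨b, hb, rfl⟩ := hzK
    exact ⟨integerLattice_sub_mem hx hz, a, ha, b, hb, by simp⟩

/-- Cramer's rule: by multilinearity only the `v i` component of `w` survives, the others repeating
a column. -/
theorem Module.Basis.det_update_self {ι R M : Type*} [Fintype ι] [DecidableEq ι] [CommRing R]
    [AddCommGroup M] [Module R M] (e v : Module.Basis ι R M) (i : ι) (w : M) :
    e.det (Function.update v i w) = v.repr w i * e.det v := by
  conv_lhs => rw [← v.sum_repr w]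
  rw [AlternatingMap.map_update_sum, Finset.sum_eq_single i]
  · simp
  · intro j _ hj
    rw [AlternatingMap.map_update_smul, AlternatingMap.map_update_self _ _ hj.symm, smul_zero]
  · simp

/-- A simplex of maximal volume in a convex body, with vertices `x₀` and `x₀ + v i`: in the
coordinates given by `v`, the body lies in the cube `[-1, 1]^d` centred at `x₀`. -/
theorem exists_basis_abs_repr_le_one {d : ℕ} {K : Set (EuclideanSpace ℝ (Fin d))}
    (hK : IsCompact K) (hint : (interior K).Nonempty) :
    ∃ (x₀ : EuclideanSpace ℝ (Fin d)) (v : Module.Basis (Fin d) ℝ (EuclideanSpace ℝ (Fin d))),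
      x₀ ∈ K ∧ (∀ i, x₀ + v i ∈ K) ∧ ∀ x ∈ K, ∀ i, |v.repr (x - x₀) i| ≤ 1 := by
  let b := (EuclideanSpace.basisFun (Fin d) ℝ).toBasis
  let f : EuclideanSpace ℝ (Fin d) × (Fin d → EuclideanSpace ℝ (Fin d)) → ℝ :=
    fun p => |b.det fun i => p.2 i - p.1|
  have hf : Continuous f := by
    refine continuous_abs.comp ?_
    simp only [Module.Basis.det_apply]
    refine Continuous.matrix_det (continuous_matrix fun i j => ?_)
    simp only [Module.Basis.toMatrix_apply, b, OrthonormalBasis.coe_toBasis_repr_apply,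
      EuclideanSpace.basisFun_repr]
    fun_prop
  obtain ⟨c, hc⟩ := hint
  obtain ⟨ε, hε, hball⟩ := Metric.isOpen_iff.mp isOpen_interior c hc
  obtain ⟨⟨x₀, x⟩, ⟨hx₀, hx⟩, hmax⟩ :=
    (hK.prod (isCompact_univ_pi fun _ : Fin d => hK)).exists_isMaxOn
      ⟨(c, fun _ => c), interior_subset hc, fun _ _ => interior_subset hc⟩ hf.continuousOn
  -- A small simplex at the interior point `c` shows that the maximal one is nondegenerate.
  have hpos : 0 < f (x₀, x) := by
    have hmem : (c, fun i => c + (ε / 2) • b i) ∈ K ×ˢ Set.univ.pi fun _ : Fin d => K := by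
      refine ⟨interior_subset hc, fun i _ => interior_subset (hball ?_)⟩
      simp [b, norm_smul, abs_of_pos hε, hε]
    refine lt_of_lt_of_le ?_ (hmax hmem)
    have : (b.det fun i => (ε / 2) • b i) = (ε / 2) ^ d := by
      simpa [b.det_self, div_pow] using b.det.map_smul_univ (fun _ => ε / 2) b
    simp only [f, add_sub_cancel_left, this]
    positivity
  have hunit : IsUnit (b.det fun i => x i - x₀) := (abs_pos.mp hpos).isUnit
  obtain ⟨hli, hsp⟩ := b.is_basis_iff_det.mpr hunit
  let v := Module.Basis.mk hli hsp.ge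
  have hv : ⇑v = fun i => x i - x₀ := Module.Basis.coe_mk _ _
  refine ⟨x₀, v, hx₀, fun i => by simpa [hv] using hx i trivial, fun y hy i => ?_⟩
  have hmem : (x₀, Function.update x i y) ∈ K ×ˢ Set.univ.pi fun _ : Fin d => K := by
    refine ⟨hx₀, fun j _ => ?_⟩
    by_cases hj : j = i
    · subst hj; simpa using hy
    · simpa [hj] using hx j trivial
  -- Moving vertex `i` to `y` scales the volume by the absolute value of the `i`-th coordinate of `y
  -- - x₀`.
  have hle : f (x₀, Function.update x i y) ≤ f (x₀, x) := hmax hmem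
  have hupd : (fun j => Function.update x i y j - x₀) = Function.update v i (y - x₀) := by
    ext1 j
    by_cases hj : j = i
    · subst hj; simp
    · simp [hj, hv]
  simp only [f, hupd, Module.Basis.det_update_self, abs_mul, ← hv] at hle hpos
  exact (mul_le_iff_le_one_left hpos).mp hle

/-- A convex set containing the simplex with vertices `x₀` and `x₀ + v i` contains a cube. -/
theorem Convex.mem_of_repr_le {d : ℕ} {E : Type*} [AddCommGroup E] [Module ℝ E] {K : Set E}
    (hK : Convex ℝ K) {x₀ : E} (v : Module.Basis (Fin d) ℝ E) (hx₀ : x₀ ∈ K)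
    (hv : ∀ i, x₀ + v i ∈ K) {y : E} (h0 : ∀ i, 0 ≤ v.repr y i)
    (h1 : ∀ i, (d + 1) * v.repr y i ≤ 1) : x₀ + y ∈ K := by
  have hsum : ∑ i, v.repr y i ≤ 1 := by
    -- Side `1/d` would do for `d > 0`; `d + 1` also covers `d = 0`.
    have : ∑ i : Fin d, v.repr y i ≤ ∑ _i : Fin d, (1 / (d + 1) : ℝ) :=
      Finset.sum_le_sum fun i _ => by
        rw [le_div_iff₀ (by positivity), mul_comm]
        exact h1 i
    refine this.trans ?_
    rw [Finset.sum_const, Finset.card_univ, Fintype.card_fin, nsmul_eq_mul, mul_one_div,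
      div_le_one (by positivity)]
    linarith
  -- Barycentric coordinates: `none` indexes the vertex `x₀`.
  have key := hK.sum_mem (t := Finset.univ) (w := fun o : Option (Fin d) =>
      o.elim (1 - ∑ i, v.repr y i) fun i => v.repr y i)
    (z := fun o : Option (Fin d) => o.elim x₀ fun i => x₀ + v i) ?_ ?_ ?_
  · convert key using 1
    simp only [Fintype.sum_option, Option.elim, smul_add, Finset.sum_add_distrib, v.sum_repr,
      ← Finset.sum_smul, ← add_assoc, ← add_smul, sub_add_cancel, one_smul]
  · rintro (_ | i) _
    · simpa using hsum
    · exact h0 i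
  · simp [Fintype.sum_option]
  · rintro (_ | i) _
    · exact hx₀
    · exact hv i

/-- Sorting the lattice points of `K - K` into cubes that fit into translates of `K`. -/
theorem ncard_integerLattice_sub_le {d : ℕ} {K : Set (EuclideanSpace ℝ (Fin d))}
    (hconv : Convex ℝ K) (hcomp : IsCompact K) (hint : (interior K).Nonempty) {M : ℕ}
    (hM : ∀ v : EuclideanSpace ℝ (Fin d), (integerLattice d ∩ (v +ᵥ K)).ncard ≤ M) :
    (integerLattice d ∩ (K - K)).ncard ≤ M * (4 * (d + 1) + 1) ^ d := by
  classical
  obtain ⟨x₀, v, hx₀, hv, hbound⟩ := exists_basis_abs_repr_le_one hcomp hint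
  have hfin : (integerLattice d ∩ (K - K)).Finite :=
    finite_integerLattice_inter (hcomp.isBounded.sub hcomp.isBounded)
  let g : EuclideanSpace ℝ (Fin d) → Fin d → ℤ := fun z i => ⌊(d + 1) * v.repr z i⌋
  let t : Finset (Fin d → ℤ) := Fintype.piFinset fun _ => Finset.Icc (-(2 * (d + 1))) (2 * (d + 1))
  have htcard : t.card = (4 * (d + 1) + 1) ^ d := by
    simp only [t, Fintype.card_piFinset, Int.card_Icc, Finset.prod_const, Finset.card_univ,
      Fintype.card_fin]
    congr 1
    omega
  rw [Set.ncard_eq_toFinset_card _ hfin, ← htcard]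
  refine Finset.card_le_mul_card_image_of_maps_to (f := g) ?_ M ?_
  · intro z hz
    obtain ⟨-, a, ha, c, hc, rfl⟩ := hfin.mem_toFinset.mp hz
    refine Fintype.mem_piFinset.mpr fun i => ?_
    have h2 : |v.repr (a - c) i| ≤ 2 := by
      have : v.repr (a - c) i = v.repr (a - x₀) i - v.repr (c - x₀) i := by simp
      rw [this]
      exact (abs_sub _ _).trans (by linarith [hbound a ha i, hbound c hc i])
    obtain ⟨hl, hr⟩ := abs_le.mp h2
    have hd : (0 : ℝ) < d + 1 := by positivity
    refine Finset.mem_Icc.mpr ⟨Int.le_floor.mpr ?_, ?_⟩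
    · push_cast
      nlinarith
    · have : (g (a - c) i : ℝ) ≤ ((2 * (d + 1) : ℤ) : ℝ) := by
        refine (Int.floor_le _).trans ?_
        push_cast
        nlinarith
      exact_mod_cast this
  · intro n _
    -- The lowest corner of cube `n`; translation by `w - x₀` carries `x₀` to it.
    let w : EuclideanSpace ℝ (Fin d) := v.equivFun.symm fun i => (n i : ℝ) / (d + 1)
    have hw : ∀ i, v.repr w i = (n i : ℝ) / (d + 1) := fun i => by
      rw [← v.equivFun_apply, LinearEquiv.apply_symm_apply]
    refine le_trans ?_ (hM (w - x₀))
    rw [← Set.ncard_coe_finset]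
    refine Set.ncard_le_ncard ?_ (finite_integerLattice_inter (hcomp.isBounded.vadd _))
    intro z hz
    obtain ⟨hzmem, rfl⟩ := Finset.mem_filter.mp (Finset.mem_coe.mp hz)
    have hd : (0 : ℝ) < d + 1 := by positivity
    have hcoord : ∀ i, (d + 1) * v.repr (z - w) i =
        (d + 1) * v.repr z i - ⌊(d + 1) * v.repr z i⌋ := fun i => by
      rw [map_sub, Finsupp.sub_apply, hw, mul_sub, mul_div_cancel₀ _ hd.ne']
    refine ⟨(hfin.mem_toFinset.mp hzmem).1, x₀ + (z - w),
      hconv.mem_of_repr_le v hx₀ hv (fun i => ?_) (fun i => ?_),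
      by simp only [vadd_eq_add]; abel⟩
    · refine nonneg_of_mul_nonneg_right ?_ hd
      rw [hcoord]
      exact Int.fract_nonneg _
    · rw [hcoord]
      exact (Int.fract_lt_one _).le

theorem mainTheorem8 (d : ℕ) :
    ∃ C : ℝ, 0 < C ∧
      ∀ K : ConvexBody (EuclideanSpace ℝ (Fin d)),
        (interior (K : Set (EuclideanSpace ℝ (Fin d)))).Nonempty →
        (∀ v : EuclideanSpace ℝ (Fin d),
          (integerLattice d ∩ (v +ᵥ (K : Set (EuclideanSpace ℝ (Fin d))))).Finite) ∧
        (integerLattice d ∩ ((K : Set (EuclideanSpace ℝ (Fin d))) -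
          (K : Set (EuclideanSpace ℝ (Fin d))))).Finite ∧
        ∃ M : ℕ,
          IsGreatest (Set.range fun v : EuclideanSpace ℝ (Fin d) =>
            (integerLattice d ∩ (v +ᵥ (K : Set (EuclideanSpace ℝ (Fin d))))).ncard) M ∧
          M ≤ (integerLattice d ∩ ((K : Set (EuclideanSpace ℝ (Fin d))) -
            (K : Set (EuclideanSpace ℝ (Fin d))))).ncard ∧
          ((integerLattice d ∩ ((K : Set (EuclideanSpace ℝ (Fin d))) -
            (K : Set (EuclideanSpace ℝ (Fin d))))).ncard : ℝ) ≤ C * (M : ℝ) := by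
  refine ⟨(4 * (d + 1) + 1) ^ d, by positivity, fun K hint => ?_⟩
  have hbdd := K.isCompact.isBounded
  have hfin := finite_integerLattice_inter (hbdd.sub hbdd)
  have hle := ncard_integerLattice_vadd_le hfin
  refine ⟨fun v => finite_integerLattice_inter (hbdd.vadd v), hfin, sSup (Set.range fun v :
    EuclideanSpace ℝ (Fin d) =>
      (integerLattice d ∩ (v +ᵥ (K : Set (EuclideanSpace ℝ (Fin d))))).ncard), ?_⟩
  have hbddAbove : BddAbove (Set.range fun v : EuclideanSpace ℝ (Fin d) =>
      (integerLattice d ∩ (v +ᵥ (K : Set (EuclideanSpace ℝ (Fin d))))).ncard) :=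
    ⟨_, Set.forall_mem_range.mpr hle⟩
  have hmax := Nat.sSup_mem (Set.range_nonempty _) hbddAbove
  refine ⟨⟨hmax, fun _ h => le_csSup hbddAbove h⟩, ?_, ?_⟩
  · obtain ⟨v, hv⟩ := hmax
    rw [← hv]
    exact hle v
  · have := ncard_integerLattice_sub_le K.convex K.isCompact hint
      fun v => le_csSup hbddAbove (Set.mem_range_self v)
    rw [mul_comm]
    exact_mod_cast this
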